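/- Let $n\ge 1$, let $U\subseteq\mathbb{R}^n$ be open, with coordinates $(r,x^2,\dots,x^n)$, and let $\bar g$ be a smooth Riemannian metric on $U$ for which these coordinates are semigeodesic, i.e. $$\bar g=(dr)^2+\sum_{i,j=2}^n\bar g_{ij}(r,x^2,\dots,x^n)\,dx^i dx^j .$$ On the set of all $(r,t,x^2,\dots,x^n)\in\mathbb{R}^{n+1}$ with $(r,0,\dots,0)\in U$ define $$h_{PW}=2\,dr\,dt+\sum_{i,j=2}^n\bar g_{ij}(r,0,\dots,0)\,dx^i dx^j .$$ This is a Lorentzian metric, and it is the plane-wave limit of $-(dt)^2+\bar g$: put $x^0=(r+t)/\sqrt2$, $x^1=(r-t)/\sqrt2$, and for $\varepsilon>0$ let $g_\varepsilon$ be the metric $-(dt)^2+\bar g$ written in the coordinates $(\tilde x^0,\tilde x^1,\tilde x^i)=(x^0,x^1/\varepsilon^2,x^i/\varepsilon)$; then, in the coordinates given by $(\tilde x^0,\tilde x^1,\tilde x^i)=(\sqrt2\,r,\,t/\sqrt2,\,x^i)$ (new $r,t$), the components of $g_\varepsilon/\varepsilon^2$ converge pointwise to those of $h_{PW}$ as $\varepsilon\to0^+$.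 Moreover: 1. If $\bar g$ is Einstein, $\mathrm{Ric}_{\bar g}=\lambda\bar g$ with a constant $\lambda\in\mathbb{R}$, then $\mathrm{Ric}_{h_{PW}}=\lambda\,(dr)^2$. 2. If $\bar g$ is locally symmetric, $\nabla\mathrm{Rm}=0$, then so is $h_{PW}$. 3. If $\bar g$ has parallel Ricci tensor, $\nabla\mathrm{Ric}=0$, then so does $h_{PW}$. -/

import Mathlib

open Filter Topology
open scoped ContDiff

/-! ### Metrics and curvature in coordinates

A coordinate system with index set `ι` has points `p : ι → ℝ`.  A (pseudo-Riemannian) metric is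
given by its matrix of components; it is only considered on an open set of points. -/

/-- A field of matrices of components `g_ij` with respect to coordinates indexed by `ι`. -/
abbrev MetricField (ι : Type) := (ι → ℝ) → Matrix ι ι ℝ

noncomputable section

section Curvature

variable {ι : Type} [Fintype ι] [DecidableEq ι]

/-- The partial derivative `∂_i f`. -/
def partialDeriv (i : ι) (f : (ι → ℝ) → ℝ) (p : ι → ℝ) : ℝ :=
  fderiv ℝ f p (Pi.single i 1)

/-- The Christoffel symbols of the Levi-Civita connection,
`Γ^k_ij = ½ g^kl (∂_i g_jl + ∂_j g_il - ∂_l g_ij)`. -/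
def christoffel (g : MetricField ι) (k i j : ι) (p : ι → ℝ) : ℝ :=
  (1 / 2 : ℝ) * ∑ l, (g p)⁻¹ k l *
    (partialDeriv i (fun q => g q j l) p + partialDeriv j (fun q => g q i l) p
      - partialDeriv l (fun q => g q i j) p)

/-- The components of the curvature endomorphism
`R(∂_i, ∂_j) ∂_k = ∇_i ∇_j ∂_k - ∇_j ∇_i ∂_k = R^l_ijk ∂_l`. -/
def curvatureEndo (g : MetricField ι) (l i j k : ι) (p : ι → ℝ) : ℝ :=
  partialDeriv i (christoffel g l j k) p - partialDeriv j (christoffel g l i k) p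
    + ∑ a, (christoffel g l i a p * christoffel g a j k p
        - christoffel g l j a p * christoffel g a i k p)

/-- The curvature 4-tensor `Rm_ijkl = g(R(∂_i, ∂_j) ∂_k, ∂_l)`. -/
def riemannTensor (g : MetricField ι) (i j k l : ι) (p : ι → ℝ) : ℝ :=
  ∑ a, curvatureEndo g a i j k p * g p a l

/-- The Ricci tensor `Ric(Y, Z) = tr (X ↦ R(X, Y) Z)`. -/
def ricci (g : MetricField ι) (j k : ι) (p : ι → ℝ) : ℝ :=
  ∑ a, curvatureEndo g a a j k p

/-- The components `(∇_a Ric)_ij`. -/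
def covDerivRicci (g : MetricField ι) (a i j : ι) (p : ι → ℝ) : ℝ :=
  partialDeriv a (ricci g i j) p
    - ∑ b, christoffel g b a i p * ricci g b j p
    - ∑ b, christoffel g b a j p * ricci g i b p

/-- The components `(∇_a Rm)_ijkl`. -/
def covDerivRiemann (g : MetricField ι) (a i j k l : ι) (p : ι → ℝ) : ℝ :=
  partialDeriv a (riemannTensor g i j k l) p
    - ∑ b, christoffel g b a i p * riemannTensor g b j k l p
    - ∑ b, christoffel g b a j p * riemannTensor g i b k l p
    - ∑ b, christoffel g b a k p * riemannTensor g i j b l p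
    - ∑ b, christoffel g b a l p * riemannTensor g i j k b p

/-- `g` is a smooth Riemannian metric on `U`. -/
def IsRiemannianOn (g : MetricField ι) (U : Set (ι → ℝ)) : Prop :=
  (∀ i j, ContDiffOn ℝ ∞ (fun p => g p i j) U) ∧ ∀ p ∈ U, (g p).PosDef

/-- `g` is a smooth Lorentzian metric on `U`: at each point it is congruent to
`diag(1, …, 1, -1, 1, …, 1)` with exactly one entry `-1`. -/
def IsLorentzianOn (g : MetricField ι) (U : Set (ι → ℝ)) : Prop :=
  (∀ i j, ContDiffOn ℝ ∞ (fun p => g p i j) U) ∧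
    ∀ p ∈ U, ∃ (i₀ : ι) (P : Matrix ι ι ℝ), IsUnit P.det ∧
      P.transpose * g p * P = Matrix.diagonal (fun i => if i = i₀ then (-1 : ℝ) else 1)

/-- `Ric = lam • g` on `U`, with a constant `lam`. -/
def IsEinsteinOn (g : MetricField ι) (U : Set (ι → ℝ)) (lam : ℝ) : Prop :=
  ∀ p ∈ U, ∀ i j, ricci g i j p = lam * g p i j

/-- `∇ Rm = 0` on `U`. -/
def IsLocallySymmetricOn (g : MetricField ι) (U : Set (ι → ℝ)) : Prop :=
  ∀ p ∈ U, ∀ a i j k l, covDerivRiemann g a i j k l p = 0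

/-- `∇ Ric = 0` on `U`. -/
def HasParallelRicciOn (g : MetricField ι) (U : Set (ι → ℝ)) : Prop :=
  ∀ p ∈ U, ∀ a i j, covDerivRicci g a i j p = 0

end Curvature

/-- The pullback `F^* g` of a metric in coordinates indexed by `κ` along a map `F` from
coordinates indexed by `ι`: `(F^* g)_ij(p) = ∂_i F^a(p) ∂_j F^b(p) g_ab(F p)`. -/
def pullbackMetric {ι κ : Type} [Fintype ι] [DecidableEq ι] [Fintype κ]
    (F : (ι → ℝ) → (κ → ℝ)) (g : MetricField κ) : MetricField ι :=
  fun p => Matrix.of fun i j =>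
    ∑ a, ∑ b, partialDeriv i (fun q => F q a) p * partialDeriv j (fun q => F q b) p * g (F p) a b

/-! ### Semigeodesic coordinates and the plane wave limit

The dimension of the Riemannian manifold is `n = m + 1`. -/

/-- Indices of the coordinates `(r, x²,…,xⁿ)`: `Sum.inl 0` is `r`, `Sum.inr i` are the others. -/
abbrev RiemIdx (m : ℕ) := Fin 1 ⊕ Fin m

/-- Indices of coordinates such as `(r, t, x²,…,xⁿ)` or `(x⁰, x¹, x²,…,xⁿ)`: `Sum.inl 0` and
`Sum.inl 1` are the first two, `Sum.inr i` are the others. -/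
abbrev LorIdx (m : ℕ) := Fin 2 ⊕ Fin m

/-- The coordinates on `U` are semigeodesic: `g = (dr)² + g_ij(r, x²,…,xⁿ) dx^i dx^j`. -/
def IsSemigeodesicOn {m : ℕ} (g : MetricField (RiemIdx m)) (U : Set (RiemIdx m → ℝ)) : Prop :=
  ∀ p ∈ U, g p (Sum.inl 0) (Sum.inl 0) = 1 ∧
    ∀ i : Fin m, g p (Sum.inl 0) (Sum.inr i) = 0 ∧ g p (Sum.inr i) (Sum.inl 0) = 0

/-- The point `(r, 0,…,0)`. -/
def axisPoint (m : ℕ) (r : ℝ) : RiemIdx m → ℝ := Sum.elim (fun _ => r) (fun _ => 0)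

/-- The metric `h_PW = 2 dr dt + g_ij(r, 0,…,0) dx^i dx^j` in the coordinates
`(r, t, x²,…,xⁿ)`. -/
def planeWave {m : ℕ} (g : MetricField (RiemIdx m)) : MetricField (LorIdx m) :=
  fun p => Matrix.fromBlocks !![0, 1; 1, 0] 0 0
    (Matrix.of fun i j => g (axisPoint m (p (Sum.inl 0))) (Sum.inr i) (Sum.inr j))

/-- The points `(r, t, x²,…,xⁿ)` with `(r, 0,…,0) ∈ U`. -/
def planeWaveDomain {m : ℕ} (U : Set (RiemIdx m → ℝ)) : Set (LorIdx m → ℝ) :=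
  {p | axisPoint m (p (Sum.inl 0)) ∈ U}

/-- The components of the one-form `dr` in the coordinates `(r, t, x²,…,xⁿ)`. -/
def drForm {m : ℕ} : LorIdx m → ℝ := Pi.single (Sum.inl 0) 1

/-- The product metric `-(dt)² + g`; its coordinates are `t` (index `Sum.inl 0`) followed by
those of `g`. -/
def productLorentz {ι : Type} (g : MetricField ι) : MetricField (Fin 1 ⊕ ι) :=
  fun p => Matrix.fromBlocks !![-1] 0 0 (g fun i => p (Sum.inr i))

/-- From the null coordinates `x⁰ = (r + t)/√2`, `x¹ = (r - t)/√2`, `x^i` back to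
`(t, r, x^i)`. -/
def fromNullCoords (m : ℕ) (x : LorIdx m → ℝ) : Fin 1 ⊕ RiemIdx m → ℝ :=
  Sum.elim (fun _ => (x (Sum.inl 0) - x (Sum.inl 1)) / √2)
    (Sum.elim (fun _ => (x (Sum.inl 0) + x (Sum.inl 1)) / √2) (fun i => x (Sum.inr i)))

/-- The inverse of `(x⁰, x¹, x^i) ↦ (x⁰, x¹/ε², x^i/ε)`. -/
def penroseScaling (m : ℕ) (ε : ℝ) (x : LorIdx m → ℝ) : LorIdx m → ℝ :=
  Sum.elim ![x (Sum.inl 0), ε ^ 2 * x (Sum.inl 1)] (fun i => ε * x (Sum.inr i))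

/-- The relabeling `(r, t, x^i) ↦ (√2 r, t/√2, x^i)`. -/
def relabel (m : ℕ) (p : LorIdx m → ℝ) : LorIdx m → ℝ :=
  Sum.elim ![√2 * p (Sum.inl 0), p (Sum.inl 1) / √2] (fun i => p (Sum.inr i))

/-- The metric `-(dt)² + g`, written in the null coordinates, pulled back by the Penrose scaling,
divided by `ε²` and relabeled.  Its limit as `ε → 0` is the plane wave limit. -/
def rescaledMetric {m : ℕ} (g : MetricField (RiemIdx m)) (ε : ℝ) : MetricField (LorIdx m) :=
  fun p => (ε ^ 2)⁻¹ •
    pullbackMetric (fun q => fromNullCoords m (penroseScaling m ε (relabel m q)))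
      (productLorentz g) p

end

/-! Write `S(r)` for the block `g_ij(r, 0)` and `A = ½ S⁻¹ S'`. The plane wave `2 dr dt + S_ij(r)
dx^i dx^j` depends on `r` alone, its Christoffel symbols involve only `A` and `S'`, and its
curvature is governed by `A' + A²` (`curvatureEndo_rosenMetric`). In semigeodesic coordinates the
`r`-lines are geodesics and `A` is the shape operator of the level sets of `r` along the axis, so
the radial Riccati equation identifies the same `A' + A²` with `R(∂_r, ·)∂_r` of `g` there
(`IsSemigeodesicOn.curvatureEndo_radial`).

Thus the only curvature components of the plane wave that can be nonzero, `Rm_rjrl` up to symmetry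
and `Ric_rr`, coincide with those of `g` on the axis, as do their `∇_r` derivatives; the remaining
covariant derivatives vanish by themselves. Each of the three conditions on `g` is therefore needed
only in its radial components on the axis. The limit statement holds because the rescaled metric is
exactly the plane wave form with the block evaluated at a point tending to the axis. -/

/-! ### Partial derivatives and smoothness of the curvature components. -/

section CoordinateCalculus

variable {ι : Type} [DecidableEq ι]

theorem partialDeriv_congr {f f' : (ι → ℝ) → ℝ} {p : ι → ℝ} (h : f =ᶠ[𝓝 p] f') (i : ι) :
    partialDeriv i f p = partialDeriv i f' p := by
  unfold partialDeriv
  rw [h.fderiv_eq]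

theorem partialDeriv_congr_of_isOpen {f f' : (ι → ℝ) → ℝ} {p : ι → ℝ} {U : Set (ι → ℝ)}
    (hU : IsOpen U) (hp : p ∈ U) (h : ∀ q ∈ U, f q = f' q) (i : ι) :
    partialDeriv i f p = partialDeriv i f' p :=
  partialDeriv_congr (eventually_of_mem (hU.mem_nhds hp) h) i

@[simp] theorem partialDeriv_const (i : ι) (c : ℝ) (p : ι → ℝ) :
    partialDeriv i (fun _ => c) p = 0 := by
  simp [partialDeriv]

variable [Fintype ι]

/-- Partial derivatives of a function of the single coordinate `q j`. -/
theorem partialDeriv_comp_apply (i j : ι) (f : ℝ → ℝ) (p : ι → ℝ) :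
    partialDeriv i (fun q => f (q j)) p = if i = j then deriv f (p j) else 0 := by
  by_cases hf : DifferentiableAt ℝ f (p j)
  · have h1 : HasFDerivAt (fun q : ι → ℝ => q j)
        (ContinuousLinearMap.proj (R := ℝ) (φ := fun _ : ι => ℝ) j) p :=
      (ContinuousLinearMap.proj (R := ℝ) (φ := fun _ : ι => ℝ) j).hasFDerivAt
    have h2 := hf.hasDerivAt.comp_hasFDerivAt p h1
    have h3 : fderiv ℝ (fun q : ι → ℝ => f (q j)) p = _ := h2.fderiv
    unfold partialDeriv
    rw [h3]
    by_cases hij : i = j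
    · subst hij; simp
    · simp [hij, Ne.symm hij]
  -- Both derivatives take the default value `0`: differentiability of the composite would pass to
  -- `f` by restriction to the `j`-th coordinate line.
  · have h : ¬ DifferentiableAt ℝ (fun q : ι → ℝ => f (q j)) p := by
      intro h
      apply hf
      have h4 : DifferentiableAt ℝ (fun s : ℝ => Function.update p j s) (p j) :=
        (hasFDerivAt_update p (p j)).differentiableAt
      have h5 : Function.update p j (p j) = p := Function.update_eq_self j p
      have h6 : DifferentiableAt ℝ (fun q : ι → ℝ => f (q j)) (Function.update p j (p j)) := by
        rwa [h5]
      simpa [Function.comp_def] using h6.comp (p j) h4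
    simp [partialDeriv, fderiv_zero_of_not_differentiableAt h,
      deriv_zero_of_not_differentiableAt hf]

theorem ContDiffOn.partialDeriv {f : (ι → ℝ) → ℝ} {U : Set (ι → ℝ)} (hU : IsOpen U)
    (hf : ContDiffOn ℝ ∞ f U) (i : ι) : ContDiffOn ℝ ∞ (partialDeriv i f) U :=
  (hf.fderiv_of_isOpen hU (by simp)).clm_apply contDiffOn_const

theorem ContDiffOn.matrix_det {E : Type*} [NormedAddCommGroup E] [NormedSpace ℝ E]
    {M : E → Matrix ι ι ℝ} {s : Set E} (hM : ∀ i j, ContDiffOn ℝ ∞ (fun x => M x i j) s) :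
    ContDiffOn ℝ ∞ (fun x => (M x).det) s := by
  simp only [Matrix.det_apply']
  exact ContDiffOn.sum fun σ _ => contDiffOn_const.mul (contDiffOn_prod fun i _ => hM _ _)

theorem ContDiffOn.matrix_inv {E : Type*} [NormedAddCommGroup E] [NormedSpace ℝ E]
    {M : E → Matrix ι ι ℝ} {s : Set E} (hM : ∀ i j, ContDiffOn ℝ ∞ (fun x => M x i j) s)
    (hdet : ∀ x ∈ s, IsUnit (M x).det) (i j : ι) :
    ContDiffOn ℝ ∞ (fun x => (M x)⁻¹ i j) s := by
  simp only [Matrix.inv_def, Matrix.smul_apply, Matrix.adjugate_apply, smul_eq_mul,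
    Ring.inverse_eq_inv']
  refine ((ContDiffOn.matrix_det hM).inv fun x hx => (hdet x hx).ne_zero).mul
    (ContDiffOn.matrix_det fun k l => ?_)
  simp only [Matrix.updateRow_apply]
  split_ifs
  · exact contDiffOn_const
  · exact hM _ _

section Smoothness

variable {g : MetricField ι} {U : Set (ι → ℝ)}

theorem contDiffOn_christoffel (hU : IsOpen U)
    (hg : ∀ i j, ContDiffOn ℝ ∞ (fun p => g p i j) U) (hdet : ∀ p ∈ U, IsUnit (g p).det)
    (k i j : ι) : ContDiffOn ℝ ∞ (christoffel g k i j) U :=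
  contDiffOn_const.mul <| ContDiffOn.sum fun l _ => (ContDiffOn.matrix_inv hg hdet k l).mul <|
    (((hg j l).partialDeriv hU i).add ((hg i l).partialDeriv hU j)).sub
      ((hg i j).partialDeriv hU l)

theorem contDiffOn_curvatureEndo (hU : IsOpen U)
    (hg : ∀ i j, ContDiffOn ℝ ∞ (fun p => g p i j) U) (hdet : ∀ p ∈ U, IsUnit (g p).det)
    (l i j k : ι) : ContDiffOn ℝ ∞ (curvatureEndo g l i j k) U := by
  have hC := contDiffOn_christoffel hU hg hdet
  exact (((hC l j k).partialDeriv hU i).sub ((hC l i k).partialDeriv hU j)).add <|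
    ContDiffOn.sum fun a _ => ((hC l i a).mul (hC a j k)).sub ((hC l j a).mul (hC a i k))

theorem contDiffOn_riemannTensor (hU : IsOpen U)
    (hg : ∀ i j, ContDiffOn ℝ ∞ (fun p => g p i j) U) (hdet : ∀ p ∈ U, IsUnit (g p).det)
    (i j k l : ι) : ContDiffOn ℝ ∞ (riemannTensor g i j k l) U :=
  ContDiffOn.sum fun a _ => (contDiffOn_curvatureEndo hU hg hdet a i j k).mul (hg a l)

theorem contDiffOn_ricci (hU : IsOpen U)
    (hg : ∀ i j, ContDiffOn ℝ ∞ (fun p => g p i j) U) (hdet : ∀ p ∈ U, IsUnit (g p).det)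
    (j k : ι) : ContDiffOn ℝ ∞ (ricci g j k) U :=
  ContDiffOn.sum fun a _ => contDiffOn_curvatureEndo hU hg hdet a a j k

end Smoothness

theorem curvatureEndo_swap (g : MetricField ι) (l i j k : ι) (p : ι → ℝ) :
    curvatureEndo g l j i k p = -curvatureEndo g l i j k p := by
  simp only [curvatureEndo, Finset.sum_sub_distrib]
  ring

end CoordinateCalculus

/-! ### Curvature of metrics depending only on `r`. -/

section RosenMetric

variable {m : ℕ}

/-- The metric `2 dr dt + S_ij(r) dx^i dx^j` in the coordinates `(r, t, x²,…,xⁿ)`. -/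
def rosenMetric (S : ℝ → Matrix (Fin m) (Fin m) ℝ) : MetricField (LorIdx m) :=
  fun p => Matrix.fromBlocks !![0, 1; 1, 0] 0 0 (S (p (Sum.inl 0)))

/-- The components of the endomorphism `½ S⁻¹ S'`. -/
noncomputable def shapeOp (S : ℝ → Matrix (Fin m) (Fin m) ℝ) (k j : Fin m) (s : ℝ) : ℝ :=
  (1 / 2 : ℝ) * ∑ l, (S s)⁻¹ k l * deriv (fun s => S s j l) s

/-- The components of the endomorphism `A' + A²`, where `A = ½ S⁻¹ S'`. -/
noncomputable def tidalOp (S : ℝ → Matrix (Fin m) (Fin m) ℝ) (l j : Fin m) (s : ℝ) : ℝ :=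
  deriv (shapeOp S l j) s + ∑ a, shapeOp S l a s * shapeOp S a j s

/-- The bilinear form obtained from `A' + A²` by lowering an index with `S`. -/
noncomputable def tidalForm (S : ℝ → Matrix (Fin m) (Fin m) ℝ) (j l : Fin m) (s : ℝ) : ℝ :=
  ∑ a, tidalOp S a j s * S s a l

/-- The Christoffel symbols of `rosenMetric S`, as functions of `r`. -/
noncomputable def rosenChristoffel (S : ℝ → Matrix (Fin m) (Fin m) ℝ) :
    LorIdx m → LorIdx m → LorIdx m → ℝ → ℝ
  | .inr k, .inl 0, .inr j => shapeOp S k j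
  | .inr k, .inr j, .inl 0 => shapeOp S k j
  | .inl 1, .inr i, .inr j => fun s => -(1 / 2 * deriv (fun s => S s i j) s)
  | _, _, _ => fun _ => 0

/-- The components `R^l_ijk` of the curvature of `rosenMetric S`, as functions of `r`. -/
noncomputable def rosenCurvature (S : ℝ → Matrix (Fin m) (Fin m) ℝ) :
    LorIdx m → LorIdx m → LorIdx m → LorIdx m → ℝ → ℝ
  | .inr l, .inl 0, .inr j, .inl 0 => tidalOp S l j
  | .inr l, .inr j, .inl 0, .inl 0 => fun s => -tidalOp S l j s
  | .inl 1, .inl 0, .inr j, .inr k => fun s => -tidalForm S j k s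
  | .inl 1, .inr j, .inl 0, .inr k => tidalForm S j k
  | _, _, _, _ => fun _ => 0

/-- The components `Rm_ijkl` of the curvature of `rosenMetric S`, as functions of `r`. -/
noncomputable def rosenRiemann (S : ℝ → Matrix (Fin m) (Fin m) ℝ) :
    LorIdx m → LorIdx m → LorIdx m → LorIdx m → ℝ → ℝ
  | .inl 0, .inr j, .inl 0, .inr l => tidalForm S j l
  | .inl 0, .inr j, .inr l, .inl 0 => fun s => -tidalForm S j l s
  | .inr j, .inl 0, .inl 0, .inr l => fun s => -tidalForm S j l s
  | .inr j, .inl 0, .inr l, .inl 0 => tidalForm S j l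
  | _, _, _, _ => fun _ => 0

/-- The components of the Ricci tensor of `rosenMetric S`, as functions of `r`. -/
noncomputable def rosenRicci (S : ℝ → Matrix (Fin m) (Fin m) ℝ) :
    LorIdx m → LorIdx m → ℝ → ℝ
  | .inl 0, .inl 0 => fun s => -∑ a, tidalOp S a a s
  | _, _ => fun _ => 0

theorem rosenMetric_inv (S : ℝ → Matrix (Fin m) (Fin m) ℝ) (p : LorIdx m → ℝ)
    (h : IsUnit (S (p (Sum.inl 0))).det) :
    (rosenMetric S p)⁻¹ = Matrix.fromBlocks !![0, 1; 1, 0] 0 0 (S (p (Sum.inl 0)))⁻¹ := by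
  apply Matrix.inv_eq_right_inv
  rw [← Matrix.fromBlocks_one, Matrix.one_fin_two]
  simp [rosenMetric, Matrix.fromBlocks_multiply, Matrix.mul_nonsing_inv _ h]

theorem christoffel_rosenMetric (S : ℝ → Matrix (Fin m) (Fin m) ℝ) (p : LorIdx m → ℝ)
    (h : IsUnit (S (p (Sum.inl 0))).det) (k i j : LorIdx m) :
    christoffel (rosenMetric S) k i j p = rosenChristoffel S k i j (p (Sum.inl 0)) := by
  have key : ∀ (a : LorIdx m) (i j : Fin m),
      partialDeriv a (fun q : LorIdx m → ℝ => S (q (Sum.inl 0)) i j) p =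
        if a = Sum.inl 0 then deriv (fun s => S s i j) (p (Sum.inl 0)) else 0 := fun a i j =>
    partialDeriv_comp_apply a (Sum.inl 0) (fun s => S s i j) p
  rw [christoffel, rosenMetric_inv S p h]
  rcases k with k | k <;> rcases i with i | i <;> rcases j with j | j <;>
    (try fin_cases k) <;> (try fin_cases i) <;> (try fin_cases j) <;>
    simp [rosenMetric, rosenChristoffel, shapeOp, key, Fintype.sum_sum_type]

variable {S : ℝ → Matrix (Fin m) (Fin m) ℝ} {D : Set ℝ}

theorem contDiffOn_deriv_entry (hD : IsOpen D)
    (hS : ∀ i j, ContDiffOn ℝ ∞ (fun s => S s i j) D) (i j : Fin m) :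
    ContDiffOn ℝ ∞ (deriv fun s => S s i j) D :=
  (hS i j).deriv_of_isOpen hD (by simp)

theorem contDiffOn_shapeOp (hD : IsOpen D) (hS : ∀ i j, ContDiffOn ℝ ∞ (fun s => S s i j) D)
    (hdet : ∀ s ∈ D, IsUnit (S s).det) (k j : Fin m) : ContDiffOn ℝ ∞ (shapeOp S k j) D :=
  contDiffOn_const.mul <| ContDiffOn.sum fun l _ =>
    (ContDiffOn.matrix_inv hS hdet k l).mul (contDiffOn_deriv_entry hD hS j l)

theorem deriv_entry_symm (hD : IsOpen D) (hsym : ∀ s ∈ D, (S s).IsSymm) {s : ℝ} (hs : s ∈ D)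
    (i j : Fin m) : deriv (fun s => S s i j) s = deriv (fun s => S s j i) s :=
  EventuallyEq.deriv_eq <| eventually_of_mem (hD.mem_nhds hs) fun x hx => (hsym x hx).apply j i

/-- Lowering the index of `A` cancels `S⁻¹`: `S A = ½ S'`. -/
theorem sum_shapeOp_mul (hdet : ∀ s ∈ D, IsUnit (S s).det) (hsym : ∀ s ∈ D, (S s).IsSymm)
    {s : ℝ} (hs : s ∈ D) (j l : Fin m) :
    ∑ a, shapeOp S a j s * S s a l = 1 / 2 * deriv (fun s => S s j l) s := by
  have h1 : ∀ b, ∑ a, (S s)⁻¹ a b * S s a l = if b = l then 1 else 0 := fun b => by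
    have h2 := congrFun (congrFun (Matrix.mul_nonsing_inv _ (hdet s hs)) l) b
    rw [Matrix.mul_apply, Matrix.one_apply] at h2
    simp only [eq_comm (a := b), ← h2]
    exact Finset.sum_congr rfl fun a _ => by rw [(hsym s hs).apply, mul_comm]
  calc ∑ a, shapeOp S a j s * S s a l
      = 1 / 2 * ∑ b, deriv (fun s => S s j b) s * ∑ a, (S s)⁻¹ a b * S s a l := by
        simp only [shapeOp, Finset.mul_sum, Finset.sum_mul]
        rw [Finset.sum_comm]
        exact Finset.sum_congr rfl fun b _ => Finset.sum_congr rfl fun a _ => by ring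
    _ = _ := by simp [h1]

/-- Differentiating `S A = ½ S'` gives `S A' = ½ S'' - S' A`, while `S A² = ½ S' A`. -/
theorem tidalForm_eq (hD : IsOpen D) (hS : ∀ i j, ContDiffOn ℝ ∞ (fun s => S s i j) D)
    (hdet : ∀ s ∈ D, IsUnit (S s).det) (hsym : ∀ s ∈ D, (S s).IsSymm)
    {s : ℝ} (hs : s ∈ D) (j l : Fin m) :
    tidalForm S j l s = 1 / 2 * deriv (deriv fun s => S s j l) s
      - 1 / 2 * ∑ a, shapeOp S a j s * deriv (fun s => S s a l) s := by
  have hdA : ∀ a, DifferentiableAt ℝ (shapeOp S a j) s := fun a =>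
    ((contDiffOn_shapeOp hD hS hdet a j).differentiableOn (by simp)).differentiableAt
      (hD.mem_nhds hs)
  have hdS : ∀ a, DifferentiableAt ℝ (fun s => S s a l) s := fun a =>
    ((hS a l).differentiableOn (by simp)).differentiableAt (hD.mem_nhds hs)
  have h1 : deriv (fun s => ∑ a, shapeOp S a j s * S s a l) s
      = deriv (fun s => 1 / 2 * deriv (fun s => S s j l) s) s :=
    EventuallyEq.deriv_eq <| eventually_of_mem (hD.mem_nhds hs) fun x hx =>
      sum_shapeOp_mul hdet hsym hx j l
  rw [deriv_fun_sum (fun a _ => (hdA a).fun_mul (hdS a)), deriv_const_mul_field] at h1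
  simp only [deriv_fun_mul (hdA _) (hdS _), Finset.sum_add_distrib] at h1
  have h2 : ∑ a, (∑ b, shapeOp S a b s * shapeOp S b j s) * S s a l
      = 1 / 2 * ∑ b, shapeOp S b j s * deriv (fun s => S s b l) s := by
    simp only [Finset.sum_mul, Finset.mul_sum]
    rw [Finset.sum_comm]
    refine Finset.sum_congr rfl fun b _ => ?_
    rw [mul_left_comm, ← sum_shapeOp_mul hdet hsym hs b l, Finset.mul_sum]
    exact Finset.sum_congr rfl fun a _ => by ring
  simp only [tidalForm, tidalOp, add_mul, Finset.sum_add_distrib, h2]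
  linarith

/-- `S''` is symmetric, and so is `S' A = ½ S' S⁻¹ S'`. -/
theorem tidalForm_symm (hD : IsOpen D) (hS : ∀ i j, ContDiffOn ℝ ∞ (fun s => S s i j) D)
    (hdet : ∀ s ∈ D, IsUnit (S s).det) (hsym : ∀ s ∈ D, (S s).IsSymm)
    {s : ℝ} (hs : s ∈ D) (j l : Fin m) : tidalForm S j l s = tidalForm S l j s := by
  have hd := fun s (hs : s ∈ D) => deriv_entry_symm hD hsym hs
  have hinv : ∀ a b, (S s)⁻¹ a b = (S s)⁻¹ b a := fun a b => by
    rw [← Matrix.transpose_apply (S s)⁻¹ a b, Matrix.transpose_nonsing_inv, (hsym s hs).eq]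
  rw [tidalForm_eq hD hS hdet hsym hs, tidalForm_eq hD hS hdet hsym hs]
  congr 2
  · exact EventuallyEq.deriv_eq <| eventually_of_mem (hD.mem_nhds hs) fun x hx => hd x hx j l
  · simp only [shapeOp, Finset.mul_sum, Finset.sum_mul]
    rw [Finset.sum_comm]
    refine Finset.sum_congr rfl fun b _ => Finset.sum_congr rfl fun a _ => ?_
    rw [hinv a b, hd s hs a l, hd s hs j b]
    ring

theorem sum_deriv_mul_shapeOp (hD : IsOpen D) (hsym : ∀ s ∈ D, (S s).IsSymm)
    {s : ℝ} (hs : s ∈ D) (i j : Fin m) :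
    ∑ a, deriv (fun s => S s i a) s * shapeOp S a j s
      = ∑ a, shapeOp S a j s * deriv (fun s => S s a i) s :=
  Finset.sum_congr rfl fun a _ => by rw [deriv_entry_symm hD hsym hs i a, mul_comm]

/-- This symmetry of `S' A` is what makes `R^t_ijr` vanish; it is read off from the symmetry of
`tidalForm` and of `S''`. -/
theorem sum_deriv_mul_shapeOp_symm (hD : IsOpen D)
    (hS : ∀ i j, ContDiffOn ℝ ∞ (fun s => S s i j) D)
    (hdet : ∀ s ∈ D, IsUnit (S s).det) (hsym : ∀ s ∈ D, (S s).IsSymm)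
    {s : ℝ} (hs : s ∈ D) (i j : Fin m) :
    ∑ a, deriv (fun s => S s i a) s * shapeOp S a j s
      = ∑ a, deriv (fun s => S s j a) s * shapeOp S a i s := by
  rw [sum_deriv_mul_shapeOp hD hsym hs, sum_deriv_mul_shapeOp hD hsym hs]
  have h1 := tidalForm_symm hD hS hdet hsym hs i j
  have h2 : deriv (deriv fun s => S s i j) s = deriv (deriv fun s => S s j i) s :=
    EventuallyEq.deriv_eq <| eventually_of_mem (hD.mem_nhds hs) fun x hx =>
      deriv_entry_symm hD hsym hx i j
  rw [tidalForm_eq hD hS hdet hsym hs, tidalForm_eq hD hS hdet hsym hs, h2] at h1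
  linarith

theorem isOpen_rosenDomain (hD : IsOpen D) : IsOpen {p : LorIdx m → ℝ | p (Sum.inl 0) ∈ D} :=
  hD.preimage (continuous_apply _)

theorem partialDeriv_rosen (hD : IsOpen D) {f : (LorIdx m → ℝ) → ℝ} {F : ℝ → ℝ}
    (h : ∀ q : LorIdx m → ℝ, q (Sum.inl 0) ∈ D → f q = F (q (Sum.inl 0)))
    {p : LorIdx m → ℝ} (hp : p (Sum.inl 0) ∈ D) (a : LorIdx m) :
    partialDeriv a f p = if a = Sum.inl 0 then deriv F (p (Sum.inl 0)) else 0 := by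
  rw [partialDeriv_congr_of_isOpen (isOpen_rosenDomain hD) hp h, partialDeriv_comp_apply]

set_option maxHeartbeats 2000000 in
theorem curvatureEndo_rosenMetric (hD : IsOpen D)
    (hS : ∀ i j, ContDiffOn ℝ ∞ (fun s => S s i j) D)
    (hdet : ∀ s ∈ D, IsUnit (S s).det) (hsym : ∀ s ∈ D, (S s).IsSymm)
    {p : LorIdx m → ℝ} (hp : p (Sum.inl 0) ∈ D) (l i j k : LorIdx m) :
    curvatureEndo (rosenMetric S) l i j k p = rosenCurvature S l i j k (p (Sum.inl 0)) := by
  have hC : ∀ a b c, ∀ q : LorIdx m → ℝ, q (Sum.inl 0) ∈ D →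
      christoffel (rosenMetric S) a b c q = rosenChristoffel S a b c (q (Sum.inl 0)) :=
    fun a b c q hq => christoffel_rosenMetric S q (hdet _ hq) a b c
  have hA : ∀ i j, ∑ a, 2⁻¹ * deriv (fun s => S s i a) (p (Sum.inl 0)) * shapeOp S a j
      (p (Sum.inl 0)) = ∑ a, 2⁻¹ * deriv (fun s => S s j a) (p (Sum.inl 0)) * shapeOp S a i
      (p (Sum.inl 0)) := fun i j => by
    simp only [mul_assoc, ← Finset.mul_sum, sum_deriv_mul_shapeOp_symm hD hS hdet hsym hp i j]
  -- The lowered Riccati expression, arranged in the form in which the index cases below leave it.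
  have hE : ∀ j k, tidalForm S j k (p (Sum.inl 0))
      = 2⁻¹ * deriv (deriv fun s => S s j k) (p (Sum.inl 0)) - ∑ a, 2⁻¹ *
        deriv (fun s => S s j a) (p (Sum.inl 0)) * shapeOp S a k (p (Sum.inl 0)) := fun j k => by
    rw [tidalForm_eq hD hS hdet hsym hp, hA, one_div]
    simp only [mul_assoc, ← Finset.mul_sum, sum_deriv_mul_shapeOp hD hsym hp]
  rw [curvatureEndo, partialDeriv_rosen hD (hC l j k) hp, partialDeriv_rosen hD (hC l i k) hp]
  simp only [hC _ _ _ p hp]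
  generalize p (Sum.inl 0) = s at *
  rcases l with l | l <;> rcases i with i | i <;> rcases j with j | j <;> rcases k with k | k <;>
    (try fin_cases l) <;> (try fin_cases i) <;> (try fin_cases j) <;> (try fin_cases k) <;>
    simp [rosenCurvature, rosenChristoffel, Fintype.sum_sum_type, tidalOp]
  · rw [hE]; ring
  · rw [hE]; ring
  -- The component `R^t_ijr`.
  · rw [hA i j]; ring
  · ring
end RosenMetric

/-! ### Lowered curvature, Ricci tensor and covariant derivatives of these metrics. -/

section RosenMetric

variable {m : ℕ} {S : ℝ → Matrix (Fin m) (Fin m) ℝ} {D : Set ℝ}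

set_option maxHeartbeats 2000000 in
-- Since `g_rt = 1` and `g_tt = 0`, an upper `t` becomes a lower `r`, and no component has a lower
-- `t`.
theorem riemannTensor_rosenMetric (hD : IsOpen D)
    (hS : ∀ i j, ContDiffOn ℝ ∞ (fun s => S s i j) D)
    (hdet : ∀ s ∈ D, IsUnit (S s).det) (hsym : ∀ s ∈ D, (S s).IsSymm)
    {p : LorIdx m → ℝ} (hp : p (Sum.inl 0) ∈ D) (i j k l : LorIdx m) :
    riemannTensor (rosenMetric S) i j k l p = rosenRiemann S i j k l (p (Sum.inl 0)) := by
  have hform : ∀ j l s, ∑ a, tidalOp S a j s * S s a l = tidalForm S j l s := fun _ _ _ => rfl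
  simp only [riemannTensor, curvatureEndo_rosenMetric hD hS hdet hsym hp]
  rcases i with i | i <;> rcases j with j | j <;> rcases k with k | k <;> rcases l with l | l <;>
    (try fin_cases i) <;> (try fin_cases j) <;> (try fin_cases k) <;> (try fin_cases l) <;>
    simp [rosenMetric, rosenCurvature, rosenRiemann, Fintype.sum_sum_type, hform]

theorem ricci_rosenMetric (hD : IsOpen D)
    (hS : ∀ i j, ContDiffOn ℝ ∞ (fun s => S s i j) D)
    (hdet : ∀ s ∈ D, IsUnit (S s).det) (hsym : ∀ s ∈ D, (S s).IsSymm)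
    {p : LorIdx m → ℝ} (hp : p (Sum.inl 0) ∈ D) (j k : LorIdx m) :
    ricci (rosenMetric S) j k p = rosenRicci S j k (p (Sum.inl 0)) := by
  simp only [ricci, curvatureEndo_rosenMetric hD hS hdet hsym hp]
  rcases j with j | j <;> rcases k with k | k <;>
    (try fin_cases j) <;> (try fin_cases k) <;>
    simp [rosenCurvature, rosenRicci, Fintype.sum_sum_type]

/-- `Ric` is a function of `r` times `dr²`, and `dr` is parallel because every `Γ^r_ij` vanishes. -/
theorem covDerivRicci_rosenMetric (hD : IsOpen D)
    (hS : ∀ i j, ContDiffOn ℝ ∞ (fun s => S s i j) D)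
    (hdet : ∀ s ∈ D, IsUnit (S s).det) (hsym : ∀ s ∈ D, (S s).IsSymm)
    {p : LorIdx m → ℝ} (hp : p (Sum.inl 0) ∈ D) (a i j : LorIdx m) :
    covDerivRicci (rosenMetric S) a i j p =
      if a = Sum.inl 0 then deriv (rosenRicci S i j) (p (Sum.inl 0)) else 0 := by
  rw [covDerivRicci, partialDeriv_rosen hD
    (fun q hq => ricci_rosenMetric hD hS hdet hsym (p := q) hq i j) hp]
  simp only [ricci_rosenMetric hD hS hdet hsym hp, christoffel_rosenMetric S p (hdet _ hp)]
  rcases a with a | a <;> rcases i with i | i <;> rcases j with j | j <;>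
    (try fin_cases a) <;> (try fin_cases i) <;> (try fin_cases j) <;>
    simp [rosenChristoffel, rosenRicci, Fintype.sum_sum_type]

set_option maxHeartbeats 4000000 in
/-- The curvature of `rosenMetric S` is parallel as soon as the `r`-derivative of its only
nontrivial components vanishes. -/
theorem covDerivRiemann_rosenMetric (hD : IsOpen D)
    (hS : ∀ i j, ContDiffOn ℝ ∞ (fun s => S s i j) D)
    (hdet : ∀ s ∈ D, IsUnit (S s).det) (hsym : ∀ s ∈ D, (S s).IsSymm)
    {p : LorIdx m → ℝ} (hp : p (Sum.inl 0) ∈ D)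
    (h : ∀ j l, deriv (tidalForm S j l) (p (Sum.inl 0))
      - ∑ b, shapeOp S b j (p (Sum.inl 0)) * tidalForm S b l (p (Sum.inl 0))
      - ∑ b, shapeOp S b l (p (Sum.inl 0)) * tidalForm S j b (p (Sum.inl 0)) = 0)
    (a i j k l : LorIdx m) : covDerivRiemann (rosenMetric S) a i j k l p = 0 := by
  rw [covDerivRiemann, partialDeriv_rosen hD
    (fun q hq => riemannTensor_rosenMetric hD hS hdet hsym (p := q) hq i j k l) hp]
  simp only [riemannTensor_rosenMetric hD hS hdet hsym hp,
    christoffel_rosenMetric S p (hdet _ hp), Fintype.sum_sum_type, Fin.sum_univ_two]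
  generalize p (Sum.inl 0) = s at *
  have h' : ∀ j l, deriv (tidalForm S j l) s = ∑ b, shapeOp S b j s * tidalForm S b l s
      + ∑ b, shapeOp S b l s * tidalForm S j b s := fun j l => by linarith [h j l]
  clear h hp hsym hdet hS hD
  rcases a with a | a
  · fin_cases a
    · rcases i with i | i <;> rcases j with j | j <;> rcases k with k | k <;>
        rcases l with l | l <;>
        (try fin_cases i) <;> (try fin_cases j) <;> (try fin_cases k) <;> (try fin_cases l) <;>
        simp [rosenChristoffel, rosenRiemann, h']
    · simp [rosenChristoffel]
  -- For a derivative along `x^i` the Christoffel corrections vanish or cancel in pairs by the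
  -- antisymmetries of `Rm`.
  · rcases i with i | i <;> rcases j with j | j <;> rcases k with k | k <;>
      rcases l with l | l <;>
      (try fin_cases i) <;> (try fin_cases j) <;> (try fin_cases k) <;> (try fin_cases l) <;>
      simp [rosenChristoffel, rosenRiemann]

end RosenMetric

/-! ### Radial curvature of `g` along the axis. -/

section Semigeodesic

variable {m : ℕ}

/-- The block `g_ij(r, 0,…,0)`, `i, j ≥ 2`, of a metric along the `r`-axis. -/
def axisBlock (g : MetricField (RiemIdx m)) (r : ℝ) : Matrix (Fin m) (Fin m) ℝ :=
  (g (axisPoint m r)).toBlocks₂₂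

theorem planeWave_eq_rosenMetric (g : MetricField (RiemIdx m)) :
    planeWave g = rosenMetric (axisBlock g) := rfl

theorem hasDerivAt_axisPoint (r : ℝ) :
    HasDerivAt (axisPoint m) (Pi.single (Sum.inl 0) 1) r := by
  rw [hasDerivAt_pi]
  rintro (i | i)
  · simpa [axisPoint, Subsingleton.elim i 0] using hasDerivAt_id' r
  · simpa [axisPoint] using hasDerivAt_const r (0 : ℝ)

theorem contDiff_axisPoint : ContDiff ℝ ∞ (axisPoint m) := by
  rw [contDiff_pi]
  rintro (i | i)
  · exact contDiff_id
  · exact contDiff_const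

/-- Radial derivatives see only the values on the axis, so identities known only there may be
differentiated in `r`. -/
theorem partialDeriv_axisPoint {f : (RiemIdx m → ℝ) → ℝ} {r : ℝ}
    (hf : DifferentiableAt ℝ f (axisPoint m r)) :
    partialDeriv (Sum.inl 0) f (axisPoint m r) = deriv (fun s => f (axisPoint m s)) r :=
  (hf.hasFDerivAt.comp_hasDerivAt r (hasDerivAt_axisPoint r)).deriv.symm

variable {U : Set (RiemIdx m → ℝ)} {g : MetricField (RiemIdx m)}

theorem isOpen_axisDomain (hU : IsOpen U) : IsOpen (axisPoint m ⁻¹' U) :=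
  hU.preimage contDiff_axisPoint.continuous

theorem contDiffOn_axisBlock (hg : IsRiemannianOn g U) (i j : Fin m) :
    ContDiffOn ℝ ∞ (fun s => axisBlock g s i j) (axisPoint m ⁻¹' U) :=
  (hg.1 (Sum.inr i) (Sum.inr j)).comp contDiff_axisPoint.contDiffOn fun _ hs => hs

theorem IsRiemannianOn.isUnit_det (hg : IsRiemannianOn g U) :
    ∀ p ∈ U, IsUnit (g p).det := fun p hp => (hg.2 p hp).det_pos.ne'.isUnit

theorem posDef_axisBlock (hg : IsRiemannianOn g U) :
    ∀ s ∈ axisPoint m ⁻¹' U, (axisBlock g s).PosDef := fun _ hs =>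
  (hg.2 _ hs).submatrix Sum.inr_injective

theorem isUnit_det_axisBlock (hg : IsRiemannianOn g U) :
    ∀ s ∈ axisPoint m ⁻¹' U, IsUnit (axisBlock g s).det := fun s hs =>
  (posDef_axisBlock hg s hs).det_pos.ne'.isUnit

theorem isSymm_axisBlock (hg : IsRiemannianOn g U) :
    ∀ s ∈ axisPoint m ⁻¹' U, (axisBlock g s).IsSymm := fun s hs => by
  simpa using (posDef_axisBlock hg s hs).isHermitian

theorem IsSemigeodesicOn.eq_fromBlocks (hsg : IsSemigeodesicOn g U) {p : RiemIdx m → ℝ}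
    (hp : p ∈ U) : g p = Matrix.fromBlocks 1 0 0 (g p).toBlocks₂₂ := by
  ext (i | i) (j | j)
  · simpa [Subsingleton.elim i 0, Subsingleton.elim j 0] using (hsg p hp).1
  · simpa [Subsingleton.elim i 0] using ((hsg p hp).2 j).1
  · simpa [Subsingleton.elim j 0] using ((hsg p hp).2 i).2
  · rfl

theorem IsSemigeodesicOn.inv_eq_fromBlocks (hg : IsRiemannianOn g U)
    (hsg : IsSemigeodesicOn g U) {p : RiemIdx m → ℝ} (hp : p ∈ U) :
    (g p)⁻¹ = Matrix.fromBlocks 1 0 0 ((g p).toBlocks₂₂)⁻¹ := by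
  have hdet : IsUnit ((g p).toBlocks₂₂).det :=
    ((hg.2 p hp).submatrix Sum.inr_injective).det_pos.ne'.isUnit
  apply Matrix.inv_eq_right_inv
  conv_lhs => rw [hsg.eq_fromBlocks hp]
  simp [Matrix.fromBlocks_multiply, Matrix.mul_nonsing_inv _ hdet]

theorem IsSemigeodesicOn.partialDeriv_inl_inl (hU : IsOpen U) (hsg : IsSemigeodesicOn g U)
    {p : RiemIdx m → ℝ} (hp : p ∈ U) (a : RiemIdx m) :
    partialDeriv a (fun q => g q (Sum.inl 0) (Sum.inl 0)) p = 0 := by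
  rw [partialDeriv_congr_of_isOpen hU hp (f' := fun _ => 1) fun q hq => (hsg q hq).1,
    partialDeriv_const]

theorem IsSemigeodesicOn.partialDeriv_inl_inr (hU : IsOpen U) (hsg : IsSemigeodesicOn g U)
    {p : RiemIdx m → ℝ} (hp : p ∈ U) (a : RiemIdx m) (i : Fin m) :
    partialDeriv a (fun q => g q (Sum.inl 0) (Sum.inr i)) p = 0 := by
  rw [partialDeriv_congr_of_isOpen hU hp (f' := fun _ => 0) fun q hq => ((hsg q hq).2 i).1,
    partialDeriv_const]

theorem IsSemigeodesicOn.partialDeriv_inr_inl (hU : IsOpen U) (hsg : IsSemigeodesicOn g U)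
    {p : RiemIdx m → ℝ} (hp : p ∈ U) (a : RiemIdx m) (i : Fin m) :
    partialDeriv a (fun q => g q (Sum.inr i) (Sum.inl 0)) p = 0 := by
  rw [partialDeriv_congr_of_isOpen hU hp (f' := fun _ => 0) fun q hq => ((hsg q hq).2 i).2,
    partialDeriv_const]

/-- The components `g_r·` are constant, so the `r`-lines are geodesics. -/
theorem IsSemigeodesicOn.christoffel_radial_radial (hU : IsOpen U) (hsg : IsSemigeodesicOn g U)
    {p : RiemIdx m → ℝ} (hp : p ∈ U) (k : RiemIdx m) :
    christoffel g k (Sum.inl 0) (Sum.inl 0) p = 0 := by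
  simp [christoffel, Fintype.sum_sum_type, hsg.partialDeriv_inl_inl hU hp,
    hsg.partialDeriv_inl_inr hU hp]

theorem IsSemigeodesicOn.christoffel_inl_radial_inr (hU : IsOpen U) (hg : IsRiemannianOn g U)
    (hsg : IsSemigeodesicOn g U) {p : RiemIdx m → ℝ} (hp : p ∈ U) (j : Fin m) :
    christoffel g (Sum.inl 0) (Sum.inl 0) (Sum.inr j) p = 0 := by
  simp [christoffel, Fintype.sum_sum_type, hsg.inv_eq_fromBlocks hg hp,
    hsg.partialDeriv_inl_inl hU hp, hsg.partialDeriv_inl_inr hU hp,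
    hsg.partialDeriv_inr_inl hU hp]

theorem IsSemigeodesicOn.christoffel_inl_inr_radial (hU : IsOpen U) (hg : IsRiemannianOn g U)
    (hsg : IsSemigeodesicOn g U) {p : RiemIdx m → ℝ} (hp : p ∈ U) (j : Fin m) :
    christoffel g (Sum.inl 0) (Sum.inr j) (Sum.inl 0) p = 0 := by
  simp [christoffel, Fintype.sum_sum_type, hsg.inv_eq_fromBlocks hg hp,
    hsg.partialDeriv_inl_inl hU hp, hsg.partialDeriv_inr_inl hU hp]

theorem IsSemigeodesicOn.christoffel_inr_radial_inr (hU : IsOpen U) (hg : IsRiemannianOn g U)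
    (hsg : IsSemigeodesicOn g U) {r : ℝ} (hr : axisPoint m r ∈ U) (k j : Fin m) :
    christoffel g (Sum.inr k) (Sum.inl 0) (Sum.inr j) (axisPoint m r)
      = shapeOp (axisBlock g) k j r := by
  have hd : ∀ i j : Fin m, partialDeriv (Sum.inl 0) (fun q => g q (Sum.inr i) (Sum.inr j))
      (axisPoint m r) = deriv (fun s => axisBlock g s i j) r := fun i j =>
    partialDeriv_axisPoint (((hg.1 _ _).differentiableOn (by simp)).differentiableAt
      (hU.mem_nhds hr))
  simp [christoffel, shapeOp, Fintype.sum_sum_type, hsg.inv_eq_fromBlocks hg hr,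
    hsg.partialDeriv_inl_inr hU hr, hd, axisBlock]

theorem IsSemigeodesicOn.christoffel_inr_inr_radial (hU : IsOpen U) (hg : IsRiemannianOn g U)
    (hsg : IsSemigeodesicOn g U) {r : ℝ} (hr : axisPoint m r ∈ U) (k j : Fin m) :
    christoffel g (Sum.inr k) (Sum.inr j) (Sum.inl 0) (axisPoint m r)
      = shapeOp (axisBlock g) k j r := by
  rw [← hsg.christoffel_inr_radial_inr hU hg hr]
  have hs : (fun q => g q (Sum.inr j) (Sum.inl 0)) =ᶠ[𝓝 (axisPoint m r)]
      fun q => g q (Sum.inl 0) (Sum.inr j) := eventually_of_mem (hU.mem_nhds hr) fun q hq =>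
    ((hsg q hq).2 j).2.trans ((hsg q hq).2 j).1.symm
  simp only [christoffel]
  congr 1
  refine Finset.sum_congr rfl fun l _ => ?_
  rw [partialDeriv_congr hs l]
  ring

/-- The radial Riccati equation: with `∇_r ∂_r = 0`, only `A' + A²` survives. -/
theorem IsSemigeodesicOn.curvatureEndo_radial (hU : IsOpen U) (hg : IsRiemannianOn g U)
    (hsg : IsSemigeodesicOn g U) {r : ℝ} (hr : axisPoint m r ∈ U) (l j : Fin m) :
    curvatureEndo g (Sum.inr l) (Sum.inl 0) (Sum.inr j) (Sum.inl 0) (axisPoint m r)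
      = tidalOp (axisBlock g) l j r := by
  have h1 : partialDeriv (Sum.inl 0) (christoffel g (Sum.inr l) (Sum.inr j) (Sum.inl 0))
      (axisPoint m r) = deriv (shapeOp (axisBlock g) l j) r := by
    rw [partialDeriv_axisPoint (((contDiffOn_christoffel hU hg.1 hg.isUnit_det _ _
      _).differentiableOn (by simp)).differentiableAt (hU.mem_nhds hr))]
    exact EventuallyEq.deriv_eq <| eventually_of_mem ((isOpen_axisDomain hU).mem_nhds hr)
      fun s hs => hsg.christoffel_inr_inr_radial hU hg hs l j
  -- A transverse derivative, so the vanishing of `Γ_rr` is needed on all of `U`, not just on the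
  -- axis.
  have h2 : partialDeriv (Sum.inr j) (christoffel g (Sum.inr l) (Sum.inl 0) (Sum.inl 0))
      (axisPoint m r) = 0 := by
    rw [partialDeriv_congr_of_isOpen hU hr (f' := fun _ => 0) fun q hq =>
      hsg.christoffel_radial_radial hU hq _, partialDeriv_const]
  simp [curvatureEndo, h1, h2, tidalOp, Fintype.sum_sum_type,
    hsg.christoffel_radial_radial hU hr, hsg.christoffel_inl_inr_radial hU hg hr,
    hsg.christoffel_inr_radial_inr hU hg hr, hsg.christoffel_inr_inr_radial hU hg hr]

theorem IsSemigeodesicOn.riemannTensor_radial (hU : IsOpen U) (hg : IsRiemannianOn g U)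
    (hsg : IsSemigeodesicOn g U) {r : ℝ} (hr : axisPoint m r ∈ U) (j l : Fin m) :
    riemannTensor g (Sum.inl 0) (Sum.inr j) (Sum.inl 0) (Sum.inr l) (axisPoint m r)
      = tidalForm (axisBlock g) j l r := by
  simp [riemannTensor, tidalForm, Fintype.sum_sum_type, hsg.curvatureEndo_radial hU hg hr,
    ((hsg _ hr).2 l).1]
  rfl

theorem IsSemigeodesicOn.ricci_radial (hU : IsOpen U) (hg : IsRiemannianOn g U)
    (hsg : IsSemigeodesicOn g U) {r : ℝ} (hr : axisPoint m r ∈ U) :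
    ricci g (Sum.inl 0) (Sum.inl 0) (axisPoint m r) = -∑ a, tidalOp (axisBlock g) a a r := by
  -- The radial term drops out of the trace by antisymmetry; the swap below accounts for the minus
  -- sign.
  have h1 : curvatureEndo g (Sum.inl 0) (Sum.inl 0) (Sum.inl 0) (Sum.inl 0) (axisPoint m r) = 0 :=
    self_eq_neg.1 (curvatureEndo_swap g _ _ _ _ _)
  simp [ricci, Fintype.sum_sum_type, h1,
    curvatureEndo_swap g _ (Sum.inl 0) (Sum.inr _) _ (axisPoint m r),
    hsg.curvatureEndo_radial hU hg hr]

theorem IsSemigeodesicOn.covDerivRicci_radial (hU : IsOpen U) (hg : IsRiemannianOn g U)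
    (hsg : IsSemigeodesicOn g U) {r : ℝ} (hr : axisPoint m r ∈ U) :
    covDerivRicci g (Sum.inl 0) (Sum.inl 0) (Sum.inl 0) (axisPoint m r)
      = deriv (fun s => -∑ a, tidalOp (axisBlock g) a a s) r := by
  have h1 : partialDeriv (Sum.inl 0) (ricci g (Sum.inl 0) (Sum.inl 0)) (axisPoint m r)
      = deriv (fun s => -∑ a, tidalOp (axisBlock g) a a s) r := by
    rw [partialDeriv_axisPoint (((contDiffOn_ricci hU hg.1 hg.isUnit_det _
      _).differentiableOn (by simp)).differentiableAt (hU.mem_nhds hr))]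
    exact EventuallyEq.deriv_eq <| eventually_of_mem ((isOpen_axisDomain hU).mem_nhds hr)
      fun s hs => hsg.ricci_radial hU hg hs
  simp [covDerivRicci, h1, hsg.christoffel_radial_radial hU hr]

/-- As `Γ^b_rr = 0` and `Γ^r_rj = 0`, the corrections involve `A` only, giving precisely the
expression required to vanish in `covDerivRiemann_rosenMetric`. -/
theorem IsSemigeodesicOn.covDerivRiemann_radial (hU : IsOpen U) (hg : IsRiemannianOn g U)
    (hsg : IsSemigeodesicOn g U) {r : ℝ} (hr : axisPoint m r ∈ U) (j l : Fin m) :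
    covDerivRiemann g (Sum.inl 0) (Sum.inl 0) (Sum.inr j) (Sum.inl 0) (Sum.inr l) (axisPoint m r)
      = deriv (tidalForm (axisBlock g) j l) r
        - ∑ b, shapeOp (axisBlock g) b j r * tidalForm (axisBlock g) b l r
        - ∑ b, shapeOp (axisBlock g) b l r * tidalForm (axisBlock g) j b r := by
  have h1 : partialDeriv (Sum.inl 0)
      (riemannTensor g (Sum.inl 0) (Sum.inr j) (Sum.inl 0) (Sum.inr l)) (axisPoint m r)
      = deriv (tidalForm (axisBlock g) j l) r := by
    rw [partialDeriv_axisPoint (((contDiffOn_riemannTensor hU hg.1 hg.isUnit_det _ _ _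
      _).differentiableOn (by simp)).differentiableAt (hU.mem_nhds hr))]
    exact EventuallyEq.deriv_eq <| eventually_of_mem ((isOpen_axisDomain hU).mem_nhds hr)
      fun s hs => hsg.riemannTensor_radial hU hg hs j l
  simp [covDerivRiemann, h1, Fintype.sum_sum_type, hsg.christoffel_radial_radial hU hr,
    hsg.christoffel_inl_radial_inr hU hg hr, hsg.christoffel_inr_radial_inr hU hg hr,
    hsg.riemannTensor_radial hU hg hr]

end Semigeodesic

/-! ### Signature of the plane wave. -/

section Lorentzian

variable {m : ℕ}

open scoped MatrixOrder in
-- Factor `M = Bᵀ B` and take `Q = B⁻¹`.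
theorem Matrix.PosDef.exists_transpose_mul_mul_eq_one {n : Type*} [Fintype n] [DecidableEq n]
    {M : Matrix n n ℝ} (hM : M.PosDef) :
    ∃ Q : Matrix n n ℝ, IsUnit Q.det ∧ Q.transpose * M * Q = 1 := by
  obtain ⟨B, hB⟩ := CStarAlgebra.nonneg_iff_eq_star_mul_self.1 hM.posSemidef.nonneg
  have hMB : M = B.transpose * B := by
    rw [hB, Matrix.star_eq_conjTranspose, Matrix.conjTranspose_eq_transpose_of_trivial]
  have hdet : IsUnit B.det := by
    have h := hM.det_pos
    rw [hMB, Matrix.det_mul, Matrix.det_transpose] at h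
    exact isUnit_iff_ne_zero.2 fun h0 => by simp [h0] at h
  refine ⟨B⁻¹, Matrix.isUnit_nonsing_inv_det _ hdet, ?_⟩
  rw [hMB, ← mul_assoc, ← Matrix.transpose_mul,
    mul_assoc, Matrix.mul_nonsing_inv _ hdet, Matrix.transpose_one, one_mul]

theorem isLorentzianOn_rosenMetric {S : ℝ → Matrix (Fin m) (Fin m) ℝ} {D : Set ℝ}
    (hS : ∀ i j, ContDiffOn ℝ ∞ (fun s => S s i j) D) (hpos : ∀ s ∈ D, (S s).PosDef) :
    IsLorentzianOn (rosenMetric S) {p | p (Sum.inl 0) ∈ D} := by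
  constructor
  · rintro (i | i) (j | j)
    · exact contDiffOn_const
    · exact contDiffOn_const
    · exact contDiffOn_const
    · exact (hS i j).comp (contDiff_apply ℝ ℝ (Sum.inl 0)).contDiffOn fun _ hp => hp
  · intro p hp
    obtain ⟨Q, hQ, hQS⟩ := (hpos _ hp).exists_transpose_mul_mul_eq_one
    have h2 : (√2)⁻¹ * (√2)⁻¹ = (2 : ℝ)⁻¹ := by rw [← mul_inv, Real.mul_self_sqrt (by norm_num)]
    -- The columns `(∂_r ± ∂_t)/√2` diagonalise `2 dr dt` to `1, -1`; `Q` orthonormalises the other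
    -- directions.
    refine ⟨Sum.inl 1, Matrix.fromBlocks !![(√2)⁻¹, (√2)⁻¹; (√2)⁻¹, -(√2)⁻¹] 0 0 Q, ?_, ?_⟩
    · rw [Matrix.det_fromBlocks_zero₂₁]
      refine IsUnit.mul ?_ hQ
      rw [Matrix.det_fin_two_of, mul_neg, h2]
      norm_num
    · have h3 : (!![(√2)⁻¹, (√2)⁻¹; (√2)⁻¹, -(√2)⁻¹] : Matrix (Fin 2) (Fin 2) ℝ).transpose
          * !![0, 1; 1, 0] * !![(√2)⁻¹, (√2)⁻¹; (√2)⁻¹, -(√2)⁻¹]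
          = Matrix.diagonal fun i => if i = 1 then -1 else 1 := by
        ext i j
        fin_cases i <;> fin_cases j <;>
          simp [Matrix.mul_apply, Fin.sum_univ_two, h2] <;> norm_num
      have h4 : (fun i : LorIdx m => if i = Sum.inl 1 then (-1 : ℝ) else 1)
          = Sum.elim (fun i => if i = 1 then -1 else 1) (fun _ => 1) := by
        funext i
        rcases i with i | i <;> simp
      rw [h4, ← Matrix.fromBlocks_diagonal, ← h3, Matrix.diagonal_one, ← hQS, rosenMetric,
        Matrix.fromBlocks_transpose, Matrix.fromBlocks_multiply, Matrix.fromBlocks_multiply]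
      simp

end Lorentzian

/-! ### The Penrose limit. -/

section PlaneWaveLimit

variable {m : ℕ}

/-- The Penrose rescaling of the coordinates: `(r, t, x^i) ↦ (r - ε²t/2, r + ε²t/2, εx^i)`. -/
theorem fromNullCoords_penroseScaling_relabel (ε : ℝ) (q : LorIdx m → ℝ) :
    fromNullCoords m (penroseScaling m ε (relabel m q)) =
      Sum.elim (fun _ => q (Sum.inl 0) + -(ε ^ 2 / 2) * q (Sum.inl 1))
        (Sum.elim (fun _ => q (Sum.inl 0) + ε ^ 2 / 2 * q (Sum.inl 1))
          fun i => ε * q (Sum.inr i)) := by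
  have h : √2 * √2 = 2 := Real.mul_self_sqrt (by norm_num)
  have h0 : √2 ≠ 0 := by positivity
  funext i
  rcases i with i | i | i
  · simp [fromNullCoords, penroseScaling, relabel]
    field_simp
    linear_combination ε ^ 2 * q (Sum.inl 1) * h
  · simp [fromNullCoords, penroseScaling, relabel]
    field_simp
    linear_combination -(ε ^ 2 * q (Sum.inl 1)) * h
  · simp [fromNullCoords, penroseScaling, relabel]

theorem partialDeriv_apply_add_mul_apply {ι : Type} [Fintype ι] [DecidableEq ι] (k i j : ι)
    (c : ℝ) (p : ι → ℝ) : partialDeriv k (fun q => q i + c * q j) p =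
      (if k = i then 1 else 0) + c * if k = j then 1 else 0 := by
  have h := fun i : ι => (ContinuousLinearMap.proj (R := ℝ) (φ := fun _ : ι => ℝ) i).hasFDerivAt
    (x := p)
  have h1 : fderiv ℝ (fun q : ι → ℝ => q i + c * q j) p = _ :=
    ((h i).add ((h j).const_mul c)).fderiv
  simp [partialDeriv, h1, Pi.single_apply, eq_comm]

theorem partialDeriv_mul_apply {ι : Type} [Fintype ι] [DecidableEq ι] (k j : ι)
    (c : ℝ) (p : ι → ℝ) : partialDeriv k (fun q => c * q j) p = if k = j then c else 0 := by
  rw [partialDeriv_comp_apply k j (fun s => c * s)]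
  simp

/-- The spatial part `(r + ε²t/2, εx^i)` of the Penrose rescaling. -/
noncomputable def penrosePoint (p : LorIdx m → ℝ) (ε : ℝ) : RiemIdx m → ℝ :=
  Sum.elim (fun _ => p (Sum.inl 0) + ε ^ 2 / 2 * p (Sum.inl 1)) fun i => ε * p (Sum.inr i)

theorem penrosePoint_zero (p : LorIdx m → ℝ) :
    penrosePoint p 0 = axisPoint m (p (Sum.inl 0)) := by
  simp [penrosePoint, axisPoint]

theorem continuous_penrosePoint (p : LorIdx m → ℝ) : Continuous (penrosePoint p) := by
  refine continuous_pi ?_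
  rintro (i | i) <;> simp only [penrosePoint, Sum.elim_inl, Sum.elim_inr] <;> fun_prop

variable {U : Set (RiemIdx m → ℝ)} {g : MetricField (RiemIdx m)}

/-- Because `-(dr - ½ε² dt)² + (dr + ½ε² dt)² = 2ε² dr dt` and each `dx^i` scales by `ε`, division
by `ε²` leaves `ε` only in the base point. -/
theorem IsSemigeodesicOn.rescaledMetric_eq (hsg : IsSemigeodesicOn g U) {p : LorIdx m → ℝ}
    {ε : ℝ} (hε : ε ≠ 0) (hp : penrosePoint p ε ∈ U) :
    rescaledMetric g ε p =
      Matrix.fromBlocks !![0, 1; 1, 0] 0 0 (g (penrosePoint p ε)).toBlocks₂₂ := by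
  have hF : (fun i : RiemIdx m => fromNullCoords m (penroseScaling m ε (relabel m p)) (Sum.inr i))
      = penrosePoint p ε := by
    rw [fromNullCoords_penroseScaling_relabel]
    rfl
  have h0 := (hsg _ hp).1
  have h1 := fun i => ((hsg _ hp).2 i).1
  have h2 := fun i => ((hsg _ hp).2 i).2
  ext i j
  simp only [rescaledMetric, pullbackMetric, productLorentz, hF]
  simp only [fromNullCoords_penroseScaling_relabel, Fintype.sum_sum_type, Sum.elim_inl,
    Sum.elim_inr, partialDeriv_apply_add_mul_apply, partialDeriv_mul_apply, Matrix.smul_apply,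
    Matrix.of_apply]
  rcases i with i | i <;> rcases j with j | j <;> (try fin_cases i) <;> (try fin_cases j) <;>
    simp [h0, h1, h2]
  · field_simp
  · field_simp
  · rw [Matrix.toBlocks₂₂, Matrix.of_apply]
    field_simp

theorem IsSemigeodesicOn.tendsto_rescaledMetric (hU : IsOpen U) (hg : IsRiemannianOn g U)
    (hsg : IsSemigeodesicOn g U) {p : LorIdx m → ℝ} (hp : p ∈ planeWaveDomain U) :
    Tendsto (fun ε : ℝ => rescaledMetric g ε p) (𝓝[>] 0) (𝓝 (planeWave g p)) := by
  have hp0 : penrosePoint p 0 ∈ U := by rw [penrosePoint_zero]; exact hp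
  have hlim : Tendsto (penrosePoint p) (𝓝[>] 0) (𝓝 (penrosePoint p 0)) :=
    (continuous_penrosePoint p).continuousAt.mono_left nhdsWithin_le_nhds
  have hev : ∀ᶠ ε in 𝓝[>] (0 : ℝ), rescaledMetric g ε p =
      Matrix.fromBlocks !![0, 1; 1, 0] 0 0 (g (penrosePoint p ε)).toBlocks₂₂ := by
    -- The exact formula needs `ε ≠ 0` and the base point in `U`; both hold for small positive `ε`.
    filter_upwards [hlim (hU.mem_nhds hp0), self_mem_nhdsWithin] with ε hε hpos
    exact hsg.rescaledMetric_eq (ne_of_gt hpos) hε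
  refine Tendsto.congr' (EventuallyEq.symm hev) ?_
  refine tendsto_pi_nhds.2 fun i => tendsto_pi_nhds.2 fun j => ?_
  rcases i with i | i <;> rcases j with j | j
  · exact tendsto_const_nhds
  · exact tendsto_const_nhds
  · exact tendsto_const_nhds
  · have hc : ContinuousAt (fun q => g q (Sum.inr i) (Sum.inr j)) (penrosePoint p 0) :=
      (hg.1 _ _).continuousOn.continuousAt (hU.mem_nhds hp0)
    have h := hc.tendsto.comp hlim
    rw [penrosePoint_zero] at h
    exact h

end PlaneWaveLimit

/-! ### The main theorem. -/

theorem mainTheorem4 (m : ℕ) (U : Set (RiemIdx m → ℝ)) (hU : IsOpen U)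
    (g : MetricField (RiemIdx m)) (hg : IsRiemannianOn g U) (hsg : IsSemigeodesicOn g U) :
    -- `planeWave g` is a Lorentzian metric and is the plane wave limit of `-(dt)² + g`
    IsLorentzianOn (planeWave g) (planeWaveDomain U) ∧
    (∀ p ∈ planeWaveDomain U,
      Tendsto (fun ε : ℝ => rescaledMetric g ε p) (𝓝[>] 0) (𝓝 (planeWave g p))) ∧
    -- 1. the Einstein case: `Ric = lam (dr)²`
    (∀ lam : ℝ, IsEinsteinOn g U lam →
      ∀ p ∈ planeWaveDomain U, ∀ α β : LorIdx m,
        ricci (planeWave g) α β p = lam * (drForm α * drForm β)) ∧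
    -- 2. local symmetry
    (IsLocallySymmetricOn g U →
      IsLocallySymmetricOn (planeWave g) (planeWaveDomain U)) ∧
    -- 3. parallel Ricci tensor
    (HasParallelRicciOn g U →
      HasParallelRicciOn (planeWave g) (planeWaveDomain U)) := by
  have hD := isOpen_axisDomain (m := m) hU
  have hS := contDiffOn_axisBlock hg
  have hdet := isUnit_det_axisBlock hg
  have hsym := isSymm_axisBlock hg
  rw [planeWave_eq_rosenMetric]
  refine ⟨isLorentzianOn_rosenMetric hS (posDef_axisBlock hg),
    fun p hp => hsg.tendsto_rescaledMetric hU hg hp, ?_, ?_, ?_⟩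
  · intro lam hE p hp α β
    -- Only the `rr` component at the axis point is used, where `g_rr = 1`.
    have h := hE _ hp (Sum.inl 0) (Sum.inl 0)
    rw [hsg.ricci_radial hU hg hp, (hsg _ hp).1, mul_one] at h
    rw [ricci_rosenMetric hD hS hdet hsym hp]
    rcases α with α | α <;> rcases β with β | β <;> (try fin_cases α) <;> (try fin_cases β) <;>
      simp [rosenRicci, drForm, h]
  · intro hsymm p hp a i j k l
    refine covDerivRiemann_rosenMetric hD hS hdet hsym hp (fun j l => ?_) a i j k l
    rw [← hsg.covDerivRiemann_radial hU hg hp]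
    exact hsymm _ hp _ _ _ _ _
  · intro hpar p hp a i j
    have h := hpar _ hp (Sum.inl 0) (Sum.inl 0) (Sum.inl 0)
    rw [hsg.covDerivRicci_radial hU hg hp] at h
    rw [covDerivRicci_rosenMetric hD hS hdet hsym hp]
    rcases i with i | i <;> rcases j with j | j <;> (try fin_cases i) <;> (try fin_cases j) <;>
      simp [rosenRicci]
    -- What remains is `∇_r Ric_rr`, supplied by `g` on the axis.
    exact fun _ => by simpa using h
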